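/- Let $\mathsf{M}$ be a matroid on a finite ground set $E$ (loops are allowed), and write $\mathcal{L}(\mathsf{N})$ for the lattice of flats of a matroid $\mathsf{N}$, ordered by inclusion. For a finite graded poset $P$ of rank $r$ with least element $\widehat{0}$ and greatest element $\widehat{1}$, its $\mathbf{a}\mathbf{b}$-index is the element of the ring $\mathbb{Z}\langle\mathbf{a},\mathbf{b}\rangle$ of polynomials in two noncommuting variables $$\Psi_P=\sum_{\mathcal{C}} w_1^{\mathcal{C}}\cdots w_{r-1}^{\mathcal{C}},\qquad w_k^{\mathcal{C}}=\begin{cases}\mathbf{b}&\text{if } \mathcal{C} \text{ contains an element of rank } k,\\ \mathbf{a}-\mathbf{b}&\text{otherwise,}\end{cases}$$ where the sum ranges over all chains $\mathcal{C}$ (including the empty one) in the open interval $(\widehat{0},\widehat{1})$ of $P$. **Theorem.** Let $i\in E$ be an element that is neither a loop nor a coloop and that is not parallel to any other element (that is, no two-element set $\{i,j\}$ is a circuit of $\mathsf{M}$). Let $\underline{\mathscr{S}}_i$ be the set of flats $F$ of $\mathsf{M}$ such that $i\notin F$, $F\cup\{i\}$ is a flat of $\mathsf{M}$, and $F\neq\widehat{0}$,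 where $\widehat{0}$ is the least flat of $\mathsf{M}$ (its set of loops). Then $$\Psi_{\mathcal{L}(\mathsf{M})}=\Psi_{\mathcal{L}(\mathsf{M}\setminus i)}+\mathbf{b}\,\Psi_{\mathcal{L}(\mathsf{M}/i)}+\sum_{F\in\underline{\mathscr{S}}_i}\Psi_{\mathcal{L}(\mathsf{M}|_F)}\,\mathbf{a}\mathbf{b}\,\Psi_{\mathcal{L}(\mathsf{M}/(F\cup\{i\}))}.$$ -/

import Mathlib

/-- The letter `a` of the ring `ℤ⟨a, b⟩` of polynomials in two noncommuting variables. -/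
noncomputable def abLetterA : FreeAlgebra ℤ (Fin 2) := FreeAlgebra.ι ℤ 0

/-- The letter `b` of the ring `ℤ⟨a, b⟩` of polynomials in two noncommuting variables. -/
noncomputable def abLetterB : FreeAlgebra ℤ (Fin 2) := FreeAlgebra.ι ℤ 1

/-- The rank of an element `x` of a finite graded poset with a least element:
the length of a longest chain ending at `x`. -/
noncomputable def posetRank {P : Type*} [PartialOrder P] (x : P) : ℕ :=
  (Order.height x).toNat

open Classical in
/-- The weight `w₁ ⋯ w_{r-1}` of a chain `C` in a finite graded bounded poset of rank `r`, where
`w_k = b` if some element of `C` has rank `k`, and `w_k = a - b` otherwise. -/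
noncomputable def chainWeight {P : Type*} [PartialOrder P] [BoundedOrder P] (C : Set P) :
    FreeAlgebra ℤ (Fin 2) :=
  ((List.range' 1 (posetRank (⊤ : P) - 1)).map fun k =>
    if ∃ c ∈ C, posetRank c = k then abLetterB else abLetterA - abLetterB).prod

/-- The `ab`-index of a finite graded bounded poset `P`: the sum of the weights of all chains
(the empty one included) in the open interval between the least and the greatest element. -/
noncomputable def abIndex (P : Type*) [PartialOrder P] [BoundedOrder P] :
    FreeAlgebra ℤ (Fin 2) :=
  ∑ᶠ C ∈ {C : Set P | IsChain (· ≤ ·) C ∧ C ⊆ Set.Ioo ⊥ ⊤}, chainWeight C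

namespace Matroid

/-- The lattice of flats of a matroid, ordered by inclusion. -/
abbrev FlatLattice {α : Type*} (M : Matroid α) : Type _ := {F : Set α // M.IsFlat F}

/-- The least flat is the set of loops, and the greatest flat is the ground set. -/
instance {α : Type*} (M : Matroid α) : BoundedOrder M.FlatLattice where
  bot := ⟨M.loops, M.isFlat_closure ∅⟩
  bot_le F := F.2.loops_subset
  top := ⟨M.E, M.ground_isFlat⟩
  le_top F := F.2.subset_ground

/-- Two distinct elements are parallel if together they form a circuit. -/
def AreParallel {α : Type*} (M : Matroid α) (e f : α) : Prop :=
  e ≠ f ∧ M.IsCircuit {e, f}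

/-- The flats `F` with `i ∉ F` for which `F ∪ {i}` is again a flat. -/
def addableFlats {α : Type*} (M : Matroid α) (i : α) : Set (Set α) :=
  {F | M.IsFlat F ∧ i ∉ F ∧ M.IsFlat (F ∪ {i})}

end Matroid

/-!
The `ab`-index of `M` is a sum over the chains `C` of flats of `M` strictly between `M.loops` and
`M.E`. Call a flat special if it has the form `F ∪ {i}` with `F` a flat avoiding `i`, that is, if
`F` is addable.

The closure in `M` embeds the flats of `M ＼ {i}` into those of `M`, preserves ranks, sends the
ground set to `M.E` because `i` is not a coloop, and its image consists of the flats that are not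
special. So the chains without a special member contribute the `ab`-index of `M ＼ {i}` (`Matroid.abIndex_delete`).

A chain with a special member has a least member containing `i`, and this member is again special,
say `F ∪ {i}` (`Matroid.chainsIn_flatsBetween_eq`). Everything below it in the chain is contained
in `F`. Such a chain therefore consists of a chain of flats strictly below `F`, possibly `F` itself,
the flat `F ∪ {i}`, and a chain strictly between `F ∪ {i}` and `M.E`. Words multiply along this
decomposition (`chainSum_mem`): if `F` is not the set of loops, the four parts contribute the
`ab`-index of `M ↾ F`, the letter `a = (a - b) + b`, the letter `b`, and the `ab`-index of
`M ／ (F ∪ {i})`. If `F` is the set of loops, the first two parts are absent and the last is the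
`ab`-index of `M ／ {i}`. The set of loops is addable because `i` is parallel to no other element
(`Matroid.IsNonloop.closure_singleton_eq`).

The four kinds of lattices of flats are compared inside `Set α`: for every minor `N` of `M` with
contracted set `X`, the map `F ↦ M.closure (F ∪ X)` embeds the flats of `N` into the flats of `M`
and shifts the rank by the rank of `X` (`Matroid.posetRank_add_natRank`, `Matroid.abIndex_minor`).
-/

/-! ### Sums over families of chains -/

open Classical in
/-- The product over the positions `k = s, …, s + n - 1` of the letter `b` if `ρ` takes the value
`k` on `C`, and of `a - b` otherwise. -/
noncomputable def rankWord {β : Type*} (ρ : β → ℕ) (s n : ℕ) (C : Set β) :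
    FreeAlgebra ℤ (Fin 2) :=
  ((List.range' s n).map fun k =>
    if ∃ c ∈ C, ρ c = k then abLetterB else abLetterA - abLetterB).prod

/-- The sum of the words `rankWord ρ s n C` over the members `C` of a family `𝒞` of sets. -/
noncomputable def chainSum {β : Type*} (ρ : β → ℕ) (s n : ℕ) (𝒞 : Set (Set β)) :
    FreeAlgebra ℤ (Fin 2) :=
  ∑ᶠ C ∈ 𝒞, rankWord ρ s n C

/-- The family of all chains contained in `A`, the empty one included. -/
def chainsIn {β : Type*} [PartialOrder β] (A : Set β) : Set (Set β) :=
  {C | IsChain (· ≤ ·) C ∧ C ⊆ A}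

section ChainSum

variable {β : Type*} {ρ : β → ℕ} {s n m : ℕ}

lemma rankWord_congr {s' : ℕ} {γ : Type*} {σ : γ → ℕ} {C : Set β} {D : Set γ}
    (h : ∀ k < n, (∃ c ∈ C, ρ c = s + k) ↔ ∃ d ∈ D, σ d = s' + k) :
    rankWord ρ s n C = rankWord σ s' n D := by
  classical
  simp only [rankWord, List.range'_eq_map_range, List.map_map]
  congr 1
  refine List.map_congr_left fun k hk => ?_
  simp only [Function.comp_apply, h k (List.mem_range.1 hk)]

lemma rankWord_union {C D : Set β} (hC : ∀ c ∈ C, ρ c < s + n) (hD : ∀ d ∈ D, s + n ≤ ρ d) :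
    rankWord ρ s (n + m) (C ∪ D) = rankWord ρ s n C * rankWord ρ (s + n) m D := by
  have h₁ : rankWord ρ s n (C ∪ D) = rankWord ρ s n C := by
    refine rankWord_congr fun k hk => ⟨?_, fun ⟨c, hc, h⟩ => ⟨c, .inl hc, h⟩⟩
    rintro ⟨c, hc | hc, h⟩
    · exact ⟨c, hc, h⟩
    · have := hD c hc; omega
  have h₂ : rankWord ρ (s + n) m (C ∪ D) = rankWord ρ (s + n) m D := by
    refine rankWord_congr fun k hk => ⟨?_, fun ⟨c, hc, h⟩ => ⟨c, .inr hc, h⟩⟩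
    rintro ⟨c, hc | hc, h⟩
    · have := hC c hc; omega
    · exact ⟨c, hc, h⟩
  rw [← h₁, ← h₂]
  simp only [rankWord]
  rw [← List.prod_append, ← List.map_append, List.range'_append_1]

/-- Chain sums are multiplicative under joining a family of low rank with a family of high rank. -/
lemma chainSum_image2_union {𝒞 𝒟 : Set (Set β)} (h𝒞 : 𝒞.Finite) (h𝒟 : 𝒟.Finite)
    (hC : ∀ C ∈ 𝒞, ∀ c ∈ C, ρ c < s + n) (hD : ∀ D ∈ 𝒟, ∀ d ∈ D, s + n ≤ ρ d) :
    chainSum ρ s (n + m) (Set.image2 (· ∪ ·) 𝒞 𝒟)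
      = chainSum ρ s n 𝒞 * chainSum ρ (s + n) m 𝒟 := by
  classical
  -- The two parts of a union are recovered from it by comparing ranks with `s + n`.
  have low : ∀ C ∈ 𝒞, ∀ D ∈ 𝒟, {x ∈ C ∪ D | ρ x < s + n} = C := fun C hC' D hD' => by
    ext x
    have := hC C hC' x
    have := hD D hD' x
    simp only [Set.mem_ofPred_eq, Set.mem_union]
    grind
  have high : ∀ C ∈ 𝒞, ∀ D ∈ 𝒟, {x ∈ C ∪ D | s + n ≤ ρ x} = D := fun C hC' D hD' => by
    ext x
    have := hC C hC' x
    have := hD D hD' x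
    simp only [Set.mem_ofPred_eq, Set.mem_union]
    grind
  have inj : Set.InjOn (fun p : Set β × Set β => p.1 ∪ p.2) (𝒞 ×ˢ 𝒟) := by
    rintro ⟨C, D⟩ ⟨h1, h2⟩ ⟨C', D'⟩ ⟨h1', h2'⟩ (h : C ∪ D = C' ∪ D')
    refine Prod.ext ?_ ?_
    · change C = C'
      rw [← low C h1 D h2, ← low C' h1' D' h2', h]
    · change D = D'
      rw [← high C h1 D h2, ← high C' h1' D' h2', h]
  rw [chainSum, ← Set.image_prod, finsum_mem_image inj,
    finsum_mem_eq_finite_toFinset_sum _ (h𝒞.prod h𝒟), chainSum, chainSum,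
    finsum_mem_eq_finite_toFinset_sum _ h𝒞, finsum_mem_eq_finite_toFinset_sum _ h𝒟,
    Finset.sum_mul_sum, ← Finset.sum_product', Set.Finite.toFinset_prod]
  refine Finset.sum_congr rfl fun p hp => ?_
  simp only [Set.Finite.mem_toFinset] at hp
  exact rankWord_union (hC _ hp.1) (hD _ hp.2)

lemma chainSum_singleton {x : β} (hx : ρ x = s) : chainSum ρ s 1 {{x}} = abLetterB := by
  simp [chainSum, rankWord, hx]

variable [PartialOrder β]

/-- An element that may or may not be used contributes `(a - b) + b = a`. -/
lemma chainSum_chainsIn_singleton {x : β} (hx : ρ x = s) :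
    chainSum ρ s 1 (chainsIn {x}) = abLetterA := by
  have : chainsIn ({x} : Set β) = {∅, {x}} := by
    ext C
    simp only [chainsIn, Set.mem_ofPred_eq, Set.subset_singleton_iff_eq, Set.mem_insert_iff,
      Set.mem_singleton_iff]
    exact ⟨fun h => h.2, fun h => ⟨by rcases h with rfl | rfl <;> simp, h⟩⟩
  rw [chainSum, this, finsum_mem_pair (Set.singleton_ne_empty x).symm]
  simp [rankWord, hx]

lemma finite_chainsIn {A : Set β} (hA : A.Finite) : (chainsIn A).Finite :=
  hA.finite_subsets.subset fun _ hC => hC.2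

lemma chainsIn_union {A B : Set β} (hAB : ∀ a ∈ A, ∀ b ∈ B, a < b) :
    chainsIn (A ∪ B) = Set.image2 (· ∪ ·) (chainsIn A) (chainsIn B) := by
  ext C
  constructor
  · rintro ⟨hC, hsub⟩
    refine ⟨C ∩ A, ⟨hC.mono Set.inter_subset_left, Set.inter_subset_right⟩,
      C ∩ B, ⟨hC.mono Set.inter_subset_left, Set.inter_subset_right⟩, ?_⟩
    change C ∩ A ∪ C ∩ B = C
    rw [← Set.inter_union_distrib_left, Set.inter_eq_self_of_subset_left hsub]
  · rintro ⟨C, ⟨hC, hCA⟩, D, ⟨hD, hDB⟩, rfl⟩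
    refine ⟨isChain_union.2 ⟨hC, hD, fun a ha b hb _ => .inl (hAB a (hCA ha) b (hDB hb)).le⟩,
      Set.union_subset_union hCA hDB⟩

/-- The sum over the chains through `x` is the product of the sum over the chains below `x`, the
letter `b`, and the sum over the chains above `x`. -/
lemma chainSum_mem {A B : Set β} {x : β} (hA : A.Finite) (hB : B.Finite) (hAx : ∀ a ∈ A, a < x)
    (hxB : ∀ b ∈ B, x < b) (hρx : ρ x = s + n) (hρA : ∀ a ∈ A, ρ a < ρ x)
    (hρB : ∀ b ∈ B, ρ x < ρ b) :
    chainSum ρ s (n + 1 + m) {C ∈ chainsIn (A ∪ {x} ∪ B) | x ∈ C}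
      = chainSum ρ s n (chainsIn A) * abLetterB * chainSum ρ (s + n + 1) m (chainsIn B) := by
  have hfam : {C ∈ chainsIn (A ∪ {x} ∪ B) | x ∈ C} = Set.image2 (· ∪ ·)
      (Set.image2 (· ∪ ·) (chainsIn A) {{x}}) (chainsIn B) := by
    rw [chainsIn_union, chainsIn_union fun a ha b hb => by rw [hb]; exact hAx a ha]
    · ext C
      constructor
      · rintro ⟨⟨_, ⟨C, hC, D, hD, rfl⟩, C', hC', rfl⟩, hx⟩
        refine ⟨_, ⟨C, hC, {x}, rfl, rfl⟩, C', hC', ?_⟩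
        rcases Set.subset_singleton_iff_eq.1 hD.2 with rfl | rfl
        · rcases hx with (hx | hx) | hx
          · exact absurd (hAx _ (hC.2 hx)) (lt_irrefl _)
          · exact absurd hx (Set.notMem_empty _)
          · exact absurd (hxB _ (hC'.2 hx)) (lt_irrefl _)
        · rfl
      · rintro ⟨_, ⟨C, hC, _, rfl, rfl⟩, C', hC', rfl⟩
        exact ⟨⟨_, ⟨C, hC, {x}, ⟨by simp, subset_rfl⟩, rfl⟩, C', hC', rfl⟩, .inl (.inr rfl)⟩
    · rintro a (ha | rfl) b hb
      · exact (hAx a ha).trans (hxB b hb)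
      · exact hxB b hb
  have hfin := finite_chainsIn hA
  have hlow : ∀ C ∈ chainsIn A, ∀ c ∈ C, ρ c < s + n := fun C hC c hc => hρx ▸ hρA c (hC.2 hc)
  have hmid : ∀ C ∈ Set.image2 (· ∪ ·) (chainsIn A) {{x}}, ∀ c ∈ C, ρ c < s + (n + 1) := by
    rintro _ ⟨C, hC, _, rfl, rfl⟩ c (hc | rfl)
    · have := hlow C hC c hc; omega
    · omega
  have hhigh : ∀ D ∈ chainsIn B, ∀ d ∈ D, s + (n + 1) ≤ ρ d := fun D hD d hd => by
    have := hρB d (hD.2 hd); omega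
  rw [hfam, chainSum_image2_union (hfin.image2 _ (Set.finite_singleton _)) (finite_chainsIn hB)
    hmid hhigh, chainSum_image2_union hfin (Set.finite_singleton _) hlow
    (by rintro _ rfl d rfl; exact hρx.ge), chainSum_singleton hρx, add_assoc s n 1]

/-- The `ab`-index of a poset can be computed after embedding the poset in an ambient order with
a function that restricts to its rank, up to a shift `s`. -/
lemma abIndex_eq_chainSum {Q : Type*} [PartialOrder Q] [BoundedOrder Q] (e : Q ↪o β)
    (hρ : ∀ q, ρ (e q) = posetRank q + s) :
    abIndex Q = chainSum ρ (s + 1) (posetRank (⊤ : Q) - 1) (chainsIn (e '' Set.Ioo ⊥ ⊤)) := by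
  have himg : chainsIn (e '' Set.Ioo ⊥ ⊤)
      = (fun C => e '' C) '' {C : Set Q | IsChain (· ≤ ·) C ∧ C ⊆ Set.Ioo ⊥ ⊤} := by
    ext D
    constructor
    · rintro ⟨hD, hsub⟩
      obtain ⟨C, hC, rfl⟩ := Set.subset_image_iff.1 hsub
      refine ⟨C, ⟨fun x hx y hy hxy => ?_, hC⟩, rfl⟩
      simpa using hD ⟨x, hx, rfl⟩ ⟨y, hy, rfl⟩ (e.injective.ne hxy)
    · rintro ⟨C, ⟨hC, hsub⟩, rfl⟩
      refine ⟨?_, Set.image_mono hsub⟩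
      rintro _ ⟨x, hx, rfl⟩ _ ⟨y, hy, rfl⟩ hxy
      simpa using hC hx hy (fun h => hxy (h ▸ rfl))
  rw [abIndex, himg, chainSum, finsum_mem_image (e.injective.image_injective.injOn)]
  refine finsum_mem_congr rfl fun C _ => ?_
  change rankWord posetRank 1 _ C = _
  refine rankWord_congr fun k _ => ?_
  simp only [Set.exists_mem_image, hρ]
  grind

end ChainSum

/-- In a poset with a least element, the rank is the only strictly monotone function that vanishes
at the least element and, for every other element, is smaller by at most one somewhere below it. -/
lemma posetRank_eq_of_strictMono {P : Type*} [PartialOrder P] [OrderBot P] {f : P → ℕ}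
    (hbot : f ⊥ = 0) (hmono : StrictMono f) (hstep : ∀ x, x ≠ ⊥ → ∃ y < x, f x ≤ f y + 1) (x : P) :
    posetRank x = f x := by
  suffices h : Order.height x = f x by rw [posetRank, h, ENat.toNat_natCast]
  refine le_antisymm ?_ ?_
  · simpa using Order.height_le_height_apply_of_strictMono f hmono x
  · induction hn : f x using Nat.strong_induction_on generalizing x with
    | _ n ih =>
      subst hn
      rcases eq_or_ne x ⊥ with rfl | hx
      · simp [hbot]
      · obtain ⟨y, hy, hxy⟩ := hstep x hx
        calc (f x : ℕ∞) ≤ (f y : ℕ∞) + 1 := by exact_mod_cast hxy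
          _ ≤ Order.height y + 1 := by gcongr; exact ih _ (hmono hy) y rfl
          _ ≤ Order.height x := Order.height_add_one_le hy

/-! ### Flats and rank -/

namespace Matroid

variable {α : Type*} {M N : Matroid α} {X F G : Set α} {i : α}

/-- The rank of a set as a natural number; it agrees with `Matroid.eRk` on matroids of finite
rank. -/
noncomputable def natRank (M : Matroid α) (X : Set α) : ℕ := (M.eRk X).toNat

lemma natRank_closure (M : Matroid α) (X : Set α) : M.natRank (M.closure X) = M.natRank X := by
  rw [natRank, eRk_closure_eq, natRank]

lemma natCast_natRank (M : Matroid α) [M.RankFinite] (X : Set α) : (M.natRank X : ℕ∞) = M.eRk X :=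
  ENat.natCast_toNat ((M.eRk_le_eRank X).trans_lt (eRank_lt_top_iff.2 ‹_›)).ne

lemma natRank_mono (M : Matroid α) [M.RankFinite] (h : F ⊆ G) : M.natRank F ≤ M.natRank G := by
  have := M.eRk_mono h
  rw [← natCast_natRank, ← natCast_natRank] at this
  exact_mod_cast this

lemma natRank_insert_le (M : Matroid α) [M.RankFinite] (e : α) (X : Set α) :
    M.natRank (insert e X) ≤ M.natRank X + 1 := by
  have := M.eRk_insert_le_add_one e X
  rw [← natCast_natRank, ← natCast_natRank] at this
  exact_mod_cast this

lemma IsFlat.natRank_insert [M.RankFinite] (hF : M.IsFlat F) {e : α} (he : e ∈ M.E) (heF : e ∉ F) :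
    M.natRank (insert e F) = M.natRank F + 1 := by
  have := M.eRk_insert_eq_add_one (X := F) (e := e) ⟨he, by rwa [hF.closure]⟩
  rw [← natCast_natRank, ← natCast_natRank] at this
  exact_mod_cast this

lemma IsFlat.natRank_lt [M.RankFinite] (hF : M.IsFlat F) (hFG : F ⊂ G) (hG : G ⊆ M.E) :
    M.natRank F < M.natRank G := by
  obtain ⟨e, heG, heF⟩ := Set.exists_of_ssubset hFG
  have h := hF.natRank_insert (hG heG) heF
  have := M.natRank_mono (Set.insert_subset heG hFG.subset)
  omega

lemma natRank_loops (M : Matroid α) : M.natRank M.loops = 0 := by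
  rw [loops, natRank_closure, natRank, eRk_empty, ENat.toNat_zero]

lemma isFlat_loops (M : Matroid α) : M.IsFlat M.loops := M.isFlat_closure ∅

lemma IsFlat.inter (hF : M.IsFlat F) (hG : M.IsFlat G) : M.IsFlat (F ∩ G) := by
  rw [isFlat_iff_closure_eq]
  refine (Set.subset_inter ?_ ?_).antisymm
    (M.subset_closure _ (Set.inter_subset_left.trans hF.subset_ground))
  · exact (M.closure_subset_closure Set.inter_subset_left).trans hF.closure.subset
  · exact (M.closure_subset_closure Set.inter_subset_right).trans hG.closure.subset

lemma IsFlat.exists_ssubset_subset_closure_insert (hF : N.IsFlat F) (hne : F ≠ N.loops) :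
    ∃ G, N.IsFlat G ∧ G ⊂ F ∧ ∃ x ∈ F, F ⊆ N.closure (insert x G) := by
  obtain ⟨I, hI⟩ := N.exists_isBasis F hF.subset_ground
  obtain ⟨x, hx⟩ : I.Nonempty := by
    rw [Set.nonempty_iff_ne_empty]
    rintro rfl
    exact hne (hF.closure.symm.trans hI.closure_eq_closure.symm)
  refine ⟨N.closure (I \ {x}), N.isFlat_closure _, ?_, x, hI.subset hx, ?_⟩
  · refine (hI.indep.closure_sdiff_singleton_ssubset hx).trans_subset ?_
    rw [hI.closure_eq_closure, hF.closure]
  · rw [closure_insert_closure_eq_closure_insert, Set.insert_sdiff_singleton,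
      Set.insert_eq_of_mem hx, hI.closure_eq_closure, hF.closure]

lemma finite_setOf_isFlat (M : Matroid α) [M.Finite] : {F | M.IsFlat F}.Finite :=
  M.ground_finite.finite_subsets.subset fun _ hF => hF.subset_ground

/-! ### The `ab`-index of a minor -/

/-- If the closure in `N` is the trace of `Y ↦ M.closure (Y ∪ X)`, as for every minor `N` of `M`
in which `X` is the contracted set, then `F ↦ M.closure (F ∪ X)` embeds the flats of `N` into the
flats of `M`. -/
noncomputable def flatEmbedding
    (h : ∀ Y ⊆ N.E, N.closure Y = M.closure (Y ∪ X) ∩ N.E) : N.FlatLattice ↪o Set α :=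
  OrderEmbedding.ofMapLEIff (fun F => M.closure (F.1 ∪ X)) fun F G => by
    refine ⟨fun hle => ?_, fun hle => M.closure_subset_closure (Set.union_subset_union_left _ hle)⟩
    change F.1 ⊆ G.1
    rw [← F.2.closure, ← G.2.closure, h _ F.2.subset_ground, h _ G.2.subset_ground]
    exact Set.inter_subset_inter_left _ hle

lemma flatEmbedding_apply (h : ∀ Y ⊆ N.E, N.closure Y = M.closure (Y ∪ X) ∩ N.E)
    (F : N.FlatLattice) : flatEmbedding h F = M.closure (F.1 ∪ X) := rfl

lemma flatEmbedding_bot (h : ∀ Y ⊆ N.E, N.closure Y = M.closure (Y ∪ X) ∩ N.E) :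
    flatEmbedding h ⊥ = M.closure X := by
  refine (Set.Subset.antisymm ?_ (M.closure_subset_closure Set.subset_union_right))
  have : N.loops ⊆ M.closure X := by
    rw [loops, h _ (Set.empty_subset _), Set.empty_union]
    exact Set.inter_subset_left
  calc M.closure (N.loops ∪ X) ⊆ M.closure (M.closure X ∪ X) :=
        M.closure_subset_closure (Set.union_subset_union_left _ this)
    _ = M.closure X := by rw [closure_union_closure_left_eq, Set.union_self]

lemma image_flatEmbedding_Ioo (h : ∀ Y ⊆ N.E, N.closure Y = M.closure (Y ∪ X) ∩ N.E) :
    flatEmbedding h '' Set.Ioo ⊥ ⊤ = {G | M.IsFlat G ∧ M.closure (G ∩ N.E ∪ X) = G ∧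
      M.closure X ⊂ G ∧ G ⊂ M.closure (N.E ∪ X)} := by
  have key : ∀ F : N.FlatLattice, flatEmbedding h F ∩ N.E = F.1 := fun F => by
    rw [flatEmbedding_apply, ← h _ F.2.subset_ground, F.2.closure]
  ext G
  constructor
  · rintro ⟨F, ⟨h₁, h₂⟩, rfl⟩
    refine ⟨M.isFlat_closure _, by rw [key]; rfl, ?_, (flatEmbedding h).lt_iff_lt.2 h₂⟩
    rw [← flatEmbedding_bot h]
    exact (flatEmbedding h).lt_iff_lt.2 h₁
  · rintro ⟨hG, hcl, h₁, h₂⟩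
    let F : N.FlatLattice := ⟨G ∩ N.E, by
      rw [isFlat_iff_closure_eq, h _ Set.inter_subset_right, hcl]⟩
    have hF : flatEmbedding h F = G := hcl
    refine ⟨F, ⟨?_, ?_⟩, hF⟩
    · rw [← (flatEmbedding h).lt_iff_lt, hF, flatEmbedding_bot]
      exact h₁
    · rw [← (flatEmbedding h).lt_iff_lt, hF]
      exact h₂

lemma posetRank_add_natRank [M.RankFinite]
    (h : ∀ Y ⊆ N.E, N.closure Y = M.closure (Y ∪ X) ∩ N.E) (F : N.FlatLattice) :
    posetRank F + M.natRank X = M.natRank (flatEmbedding h F) := by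
  have hle : ∀ F, M.natRank X ≤ M.natRank (flatEmbedding h F) := fun F => by
    rw [flatEmbedding_apply, natRank_closure]
    exact M.natRank_mono Set.subset_union_right
  have hmono : StrictMono fun F => M.natRank (flatEmbedding h F) := fun F G hFG =>
    (M.isFlat_closure _).natRank_lt ((flatEmbedding h).lt_iff_lt.2 hFG) (M.closure_subset_ground _)
  have hrank : posetRank F = M.natRank (flatEmbedding h F) - M.natRank X := by
    refine posetRank_eq_of_strictMono (f := fun F => M.natRank (flatEmbedding h F) - M.natRank X)
      ?_ (fun F G hFG => ?_) (fun F hF => ?_) F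
    · simp only [flatEmbedding_bot, natRank_closure, Nat.sub_self]
    · have : M.natRank (flatEmbedding h F) < M.natRank (flatEmbedding h G) := hmono hFG
      have := hle F
      change _ - _ < _ - _
      omega
    · obtain ⟨G, hG, hGF, x, hx, hsub⟩ := F.2.exists_ssubset_subset_closure_insert
        (fun h' => hF (Subtype.ext h'))
      refine ⟨⟨G, hG⟩, hGF, ?_⟩
      have hsub' : F.1 ∪ X ⊆ M.closure (insert x (G ∪ X)) ∪ X := by
        refine Set.union_subset_union_left _ (hsub.trans ?_)
        rw [h _ (Set.insert_subset (F.2.subset_ground hx) hG.subset_ground), Set.insert_union]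
        exact Set.inter_subset_left
      have h₁ : M.natRank (flatEmbedding h F) ≤ M.natRank (insert x (G ∪ X)) := by
        rw [flatEmbedding_apply, natRank_closure]
        refine (M.natRank_mono hsub').trans ?_
        rw [← natRank_closure, closure_union_closure_left_eq, Set.union_eq_self_of_subset_right
          (Set.subset_union_right.trans (Set.subset_insert _ _)), natRank_closure]
      have h₂ := M.natRank_insert_le x (G ∪ X)
      have h₃ : M.natRank (flatEmbedding h ⟨G, hG⟩) = M.natRank (G ∪ X) := by
        rw [flatEmbedding_apply, natRank_closure]
      simp only [h₃]
      omega
  have := hle F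
  omega

/-- The flats of `M` strictly between `A` and `B`. -/
def flatsBetween (M : Matroid α) (A B : Set α) : Set (Set α) := {G | M.IsFlat G ∧ A ⊂ G ∧ G ⊂ B}

lemma abIndex_minor [M.RankFinite] (h : ∀ Y ⊆ N.E, N.closure Y = M.closure (Y ∪ X) ∩ N.E) :
    abIndex N.FlatLattice = chainSum M.natRank (M.natRank X + 1)
      (M.natRank (N.E ∪ X) - M.natRank X - 1)
      (chainsIn {G ∈ M.flatsBetween (M.closure X) (M.closure (N.E ∪ X)) |
        M.closure (G ∩ N.E ∪ X) = G}) := by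
  rw [abIndex_eq_chainSum (flatEmbedding h) (fun F => (posetRank_add_natRank h F).symm),
    image_flatEmbedding_Ioo]
  congr 1
  · have := posetRank_add_natRank h ⊤
    rw [flatEmbedding_apply, natRank_closure] at this
    change _ = M.natRank (N.E ∪ X) at this
    omega
  · congr 1
    ext G
    simp only [flatsBetween, Set.mem_ofPred_eq]
    tauto

lemma abIndex_flatLattice (M : Matroid α) [M.RankFinite] :
    abIndex M.FlatLattice = chainSum M.natRank 1 (M.natRank M.E - 1)
      (chainsIn (M.flatsBetween M.loops M.E)) := by
  rw [abIndex_minor (M := M) (X := ∅) fun Y hY => by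
    rw [Set.union_empty, Set.inter_eq_self_of_subset_left (M.closure_subset_ground _)]]
  simp only [Set.union_empty, closure_ground]
  congr 1
  · simp [natRank]
  · simp [natRank]
  · congr 1
    ext G
    refine and_iff_left_of_imp fun hG => ?_
    rw [Set.inter_eq_self_of_subset_left hG.1.subset_ground, hG.1.closure]

lemma abIndex_restrict [M.RankFinite] (hF : M.IsFlat F) :
    abIndex (M.restrict F).FlatLattice = chainSum M.natRank 1 (M.natRank F - 1)
      (chainsIn (M.flatsBetween M.loops F)) := by
  rw [abIndex_minor (M := M) (X := ∅) fun Y hY => by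
    rw [Set.union_empty, restrict_ground_eq, restrict_closure_eq M (R := F) hY hF.subset_ground]]
  simp only [Set.union_empty, restrict_ground_eq, hF.closure]
  congr 1
  · simp [natRank]
  · simp [natRank]
  · congr 1
    ext G
    refine and_iff_left_of_imp fun hG => ?_
    rw [Set.inter_eq_self_of_subset_left hG.2.2.subset, hG.1.closure]

lemma abIndex_contract [M.RankFinite] (hX : X ⊆ M.E) :
    abIndex (M.contract X).FlatLattice = chainSum M.natRank (M.natRank X + 1)
      (M.natRank M.E - M.natRank X - 1) (chainsIn (M.flatsBetween (M.closure X) M.E)) := by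
  rw [abIndex_minor (M := M) (X := X) fun Y hY => by
    rw [contract_closure_eq, contract_ground, ← Set.inter_sdiff_assoc,
      Set.inter_eq_self_of_subset_left (M.closure_subset_ground _)]]
  rw [contract_ground, Set.sdiff_union_of_subset hX, closure_ground]
  congr 2
  ext G
  refine and_iff_left_of_imp fun hG => ?_
  have hXG : X ⊆ G := (M.subset_closure X hX).trans hG.2.1.subset
  rw [← Set.inter_sdiff_assoc, Set.inter_eq_self_of_subset_left hG.1.subset_ground,
    Set.sdiff_union_of_subset hXG, hG.1.closure]

/-- The flats of the deletion `M ＼ {i}` correspond to the flats of `M` that are not of the form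
`F ∪ {i}` with `F` a flat avoiding `i`. -/
lemma abIndex_delete [M.RankFinite] (hi : i ∈ M.E) (hcoloop : ¬ M.IsColoop i) :
    abIndex (M.delete {i}).FlatLattice = chainSum M.natRank 1 (M.natRank M.E - 1)
      (chainsIn {G ∈ M.flatsBetween M.loops M.E | ¬ (i ∈ G ∧ M.IsFlat (G \ {i}))}) := by
  have hcl : M.closure (M.E \ {i}) = M.E := by
    simpa [isColoop_iff_sdiff_closure] using hcoloop
  rw [abIndex_minor (M := M) (X := ∅) fun Y hY => by
    rw [Set.union_empty, delete_closure_eq_of_disjoint, delete_ground, ← Set.inter_sdiff_assoc,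
      Set.inter_eq_self_of_subset_left (M.closure_subset_ground _)]
    exact Set.disjoint_of_subset_left hY Set.disjoint_sdiff_left]
  simp only [Set.union_empty, delete_ground, hcl]
  congr 1
  · simp [natRank]
  · rw [← natRank_closure, hcl]; simp [natRank]
  · congr 1
    ext G
    refine and_congr_right fun hG => ?_
    rw [← Set.inter_sdiff_assoc, Set.inter_eq_self_of_subset_left hG.1.subset_ground]
    by_cases hiG : i ∈ G
    · rw [not_and, imp_iff_right hiG, isFlat_iff_closure_eq]
      refine ⟨fun h h' => ?_, fun h => ?_⟩
      · rw [h] at h'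
        exact (h' ▸ hiG : i ∈ G \ {i}).2 rfl
      -- The closure of `G \ {i}` contains `G \ {i}` strictly and is contained in `G`.
      · have h₁ : M.closure (G \ {i}) ⊆ G :=
          (M.closure_subset_closure Set.sdiff_subset).trans hG.1.closure.subset
        have h₂ : G \ {i} ⊆ M.closure (G \ {i}) :=
          M.subset_closure _ (Set.sdiff_subset.trans hG.1.subset_ground)
        refine h₁.antisymm fun x hx => ?_
        by_contra hx'
        obtain rfl : x = i := by
          by_contra hxi
          exact hx' (h₂ ⟨hx, hxi⟩)
        exact h (Set.Subset.antisymm (fun y hy => ⟨h₁ hy, fun hyx => hx' (hyx ▸ hy)⟩) h₂)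
    · simp [hiG, hG.1.closure]

end Matroid

/-! ### Chains through an added element -/

namespace Matroid

variable {α : Type*} {M : Matroid α} {X F : Set α} {i : α}

/-- An element that is parallel to no other element spans only itself and the loops. -/
lemma IsNonloop.closure_singleton_eq (hi : M.IsNonloop i) (hparallel : ∀ j, ¬ M.AreParallel i j) :
    M.closure {i} = M.loops ∪ {i} := by
  have hiE := hi.mem_ground
  refine Set.Subset.antisymm (fun j hj => ?_) (Set.union_subset
    (M.closure_subset_closure (Set.empty_subset _))
    (M.subset_closure _ (Set.singleton_subset_iff.2 hiE)))
  by_contra hj'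
  simp only [Set.mem_union, Set.mem_singleton_iff, not_or] at hj'
  have hjE : j ∈ M.E := M.closure_subset_ground _ hj
  have hjn : M.IsNonloop j := ⟨hj'.1, hjE⟩
  have hdep : ¬ M.Indep {i, j} := by
    rw [Set.pair_comm]
    intro h
    have := h.notMem_closure_sdiff_of_mem (Set.mem_insert j {i})
    rw [Set.insert_sdiff_self_of_notMem (by simpa using hj'.2)] at this
    exact this hj
  refine hparallel j ⟨fun h => hj'.2 h.symm, ?_⟩
  rw [isCircuit_iff_forall_ssubset]
  refine ⟨⟨hdep, Set.insert_subset hiE (Set.singleton_subset_iff.2 hjE)⟩, fun I hI => ?_⟩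
  obtain ⟨e, he, hIe⟩ := Set.ssubset_iff_sdiff_singleton.1 hI
  rcases he with rfl | rfl
  · refine hjn.indep.subset (hIe.trans ?_)
    rintro x ⟨rfl | hx, hxe⟩
    · exact absurd rfl hxe
    · exact hx
  · refine hi.indep.subset (hIe.trans ?_)
    rintro x ⟨hx | rfl, hxe⟩
    · exact hx
    · exact absurd rfl hxe

/-- The chains of flats strictly between `M.loops` and `M.E` whose least member containing `i` is
`F ∪ {i}`. -/
def chainsThrough (M : Matroid α) (i : α) (F : Set α) : Set (Set (Set α)) :=
  {C ∈ chainsIn (M.flatsBetween M.loops M.E) | F ∪ {i} ∈ C ∧ ∀ G ∈ C, G ⊂ F ∪ {i} → i ∉ G}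

lemma finite_flatsBetween (M : Matroid α) [M.Finite] (A B : Set α) : (M.flatsBetween A B).Finite :=
  M.finite_setOf_isFlat.subset fun _ hG => hG.1

lemma finite_addableFlats (M : Matroid α) [M.Finite] (i : α) : (M.addableFlats i).Finite :=
  M.finite_setOf_isFlat.subset fun _ hF => hF.1

lemma finite_chainsThrough (M : Matroid α) [M.Finite] (i : α) (F : Set α) :
    (M.chainsThrough i F).Finite :=
  (finite_chainsIn (M.finite_flatsBetween _ _)).subset fun _ hC => hC.1

lemma chainsThrough_pairwiseDisjoint (M : Matroid α) (i : α) :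
    (M.addableFlats i).PairwiseDisjoint (M.chainsThrough i) := by
  intro F hF F' hF' hne
  refine Set.disjoint_left.2 fun C hC hC' => hne ?_
  have heq : F ∪ {i} = F' ∪ {i} := by
    by_contra h
    rcases hC.1.1 hC.2.1 hC'.2.1 h with hle | hle
    · exact hC'.2.2 _ hC.2.1 (hle.lt_of_ne h) (.inr rfl)
    · exact hC.2.2 _ hC'.2.1 (hle.lt_of_ne (Ne.symm h)) (.inr rfl)
  have h₁ : ∀ {A : Set α}, i ∉ A → (A ∪ {i}) \ {i} = A := fun hA => by
    rw [Set.union_sdiff_right, Set.sdiff_singleton_eq_self hA]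
  rw [← h₁ hF.2.1, heq, h₁ hF'.2.1]

/-- A chain either has no member `F ∪ {i}` with `F` addable, or its least member containing `i` is
of this form. Indeed, if `G ∋ i` is a flat contained in `F ∪ {i}`, then `G \ {i} = G ∩ F` is an
intersection of two flats. -/
lemma chainsIn_flatsBetween_eq (M : Matroid α) [M.Finite] (i : α) :
    chainsIn (M.flatsBetween M.loops M.E)
      = chainsIn {G ∈ M.flatsBetween M.loops M.E | ¬ (i ∈ G ∧ M.IsFlat (G \ {i}))}
        ∪ ⋃ F ∈ M.addableFlats i, M.chainsThrough i F := by
  ext C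
  constructor
  · intro hC
    by_cases h : ∃ G ∈ C, i ∈ G ∧ M.IsFlat (G \ {i})
    · right
      obtain ⟨G, hGC, hiG, hG⟩ := h
      have hfin : {G ∈ C | i ∈ G}.Finite :=
        ((M.finite_flatsBetween _ _).subset hC.2).subset fun _ h => h.1
      -- In a chain, a minimal member containing `i` is the least one.
      obtain ⟨G₀, hG₀⟩ := hfin.exists_minimal ⟨G, hGC, hiG⟩
      have hle : G₀ ⊆ G := by
        rcases hC.1.total hG₀.prop.1 hGC with h | h
        · exact h
        · exact hG₀.le_of_le ⟨hGC, hiG⟩ h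
      have hunion : G₀ \ {i} ∪ {i} = G₀ :=
        Set.sdiff_union_of_subset (Set.singleton_subset_iff.2 hG₀.prop.2)
      have hflat : M.IsFlat G₀ := (hC.2 hG₀.prop.1).1
      have hflat' : M.IsFlat (G₀ \ {i}) := by
        convert hflat.inter hG using 1
        rw [← Set.inter_sdiff_assoc, Set.inter_eq_self_of_subset_left hle]
      refine Set.mem_biUnion (x := G₀ \ {i}) ⟨hflat', fun h => h.2 rfl, hunion.symm ▸ hflat⟩ ?_
      refine ⟨hC, hunion.symm ▸ hG₀.prop.1, fun G' hG' hlt hiG' => ?_⟩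
      rw [hunion] at hlt
      exact hlt.2 (hG₀.le_of_le ⟨hG', hiG'⟩ hlt.1)
    · left
      push Not at h
      exact ⟨hC.1, fun G hG => ⟨hC.2 hG, fun h' => h G hG h'.1 h'.2⟩⟩
  · rintro (hC | hC)
    · exact ⟨hC.1, hC.2.trans (Set.sep_subset _ _)⟩
    · obtain ⟨F, _, hCF⟩ := Set.mem_iUnion₂.1 hC
      exact hCF.1

lemma chainsThrough_eq (hi : M.IsNonloop i) (hcoloop : ¬ M.IsColoop i)
    (hF : F ∈ M.addableFlats i) :
    M.chainsThrough i F = {C ∈ chainsIn ({G | M.IsFlat G ∧ M.loops ⊂ G ∧ G ⊆ F} ∪ {F ∪ {i}}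
      ∪ M.flatsBetween (F ∪ {i}) M.E) | F ∪ {i} ∈ C} := by
  obtain ⟨hFf, hiF, hFi⟩ := hF
  have hlt : M.loops ⊂ F ∪ {i} :=
    ⟨hFi.loops_subset, fun h => hi.not_isLoop (h (.inr rfl))⟩
  have hlt' : F ∪ {i} ⊂ M.E := by
    refine hFi.subset_ground.ssubset_of_ne fun h => hcoloop ?_
    rw [isColoop_iff_sdiff_closure, ← h, Set.union_sdiff_right, Set.sdiff_singleton_eq_self hiF,
      hFf.closure]
    exact fun h' => hiF (h' ▸ .inr rfl)
  ext C
  constructor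
  · rintro ⟨⟨hC, hsub⟩, hx, hmin⟩
    refine ⟨⟨hC, fun G hG => ?_⟩, hx⟩
    obtain ⟨hGf, hG₁, hG₂⟩ := hsub hG
    rcases eq_or_ne G (F ∪ {i}) with h | h
    · exact .inl (.inr h)
    · rcases hC hG hx h with hle | hle
      · have hiG := hmin G hG (hle.lt_of_ne h)
        refine .inl (.inl ⟨hGf, hG₁, fun x hxG => (hle hxG).resolve_right ?_⟩)
        rintro rfl
        exact hiG hxG
      · exact .inr ⟨hGf, hle.lt_of_ne h.symm, hG₂⟩
  · rintro ⟨⟨hC, hsub⟩, hx⟩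
    refine ⟨⟨hC, fun G hG => ?_⟩, hx, fun G hG hGlt hiG => ?_⟩
    · rcases hsub hG with (h | rfl) | h
      · exact ⟨h.1, h.2.1, (h.2.2.trans Set.subset_union_left).trans_ssubset hlt'⟩
      · exact ⟨hFi, hlt, hlt'⟩
      · exact ⟨h.1, hlt.trans h.2.1, h.2.2⟩
    · rcases hsub hG with (h | rfl) | h
      · exact hiF (h.2.2 hiG)
      · exact hGlt.ne rfl
      · exact hGlt.not_subset h.2.1.subset

lemma chainSum_chainsThrough [M.Finite] (hi : M.IsNonloop i) (hcoloop : ¬ M.IsColoop i)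
    (hF : F ∈ M.addableFlats i) (hX : X ⊆ M.E) (hcl : M.closure X = F ∪ {i}) :
    chainSum M.natRank 1 (M.natRank M.E - 1) (M.chainsThrough i F)
      = chainSum M.natRank 1 (M.natRank F) (chainsIn {G | M.IsFlat G ∧ M.loops ⊂ G ∧ G ⊆ F})
        * abLetterB * abIndex (M.contract X).FlatLattice := by
  have hmem := chainsThrough_eq hi hcoloop hF
  obtain ⟨hFf, hiF, hFi⟩ := hF
  have hrank : M.natRank (F ∪ {i}) = M.natRank F + 1 := by
    rw [Set.union_singleton]
    exact hFf.natRank_insert hi.mem_ground hiF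
  have hlt : F ∪ {i} ⊂ M.E := by
    refine hFi.subset_ground.ssubset_of_ne fun h => hcoloop ?_
    rw [isColoop_iff_sdiff_closure, ← h, Set.union_sdiff_right, Set.sdiff_singleton_eq_self hiF,
      hFf.closure]
    exact fun h' => hiF (h' ▸ .inr rfl)
  have hrank_lt := hFi.natRank_lt hlt subset_rfl
  have hFlt : F ⊂ F ∪ {i} := ⟨Set.subset_union_left, fun h => hiF (h (.inr rfl))⟩
  rw [abIndex_contract hX, hcl, ← M.natRank_closure X, hcl, hmem,
    show M.natRank M.E - 1 = M.natRank F + 1 + (M.natRank M.E - M.natRank (F ∪ {i}) - 1) by omega,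
    chainSum_mem (M.finite_setOf_isFlat.subset fun _ h => h.1) (M.finite_flatsBetween _ _)
      (fun G hG => hG.2.2.trans_ssubset hFlt) (fun G hG => hG.2.1) (by omega)
      (fun G hG => hG.1.natRank_lt (hG.2.2.trans_ssubset hFlt) hFi.subset_ground)
      (fun G hG => hFi.natRank_lt hG.2.1 hG.1.subset_ground), hrank, add_comm 1]

/-- Below `F ∪ {i}` there is an optional member `F`, which contributes the letter `a`, and a chain
of flats strictly below `F`. -/
lemma chainSum_flats_subset [M.Finite] (hF : M.IsFlat F) (hne : F ≠ M.loops) :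
    chainSum M.natRank 1 (M.natRank F) (chainsIn {G | M.IsFlat G ∧ M.loops ⊂ G ∧ G ⊆ F})
      = abIndex (M.restrict F).FlatLattice * abLetterA := by
  have hlt : M.loops ⊂ F := hF.loops_subset.ssubset_of_ne hne.symm
  have hset : {G | M.IsFlat G ∧ M.loops ⊂ G ∧ G ⊆ F} = M.flatsBetween M.loops F ∪ {F} := by
    ext G
    constructor
    · rintro ⟨h₁, h₂, h₃⟩
      exact (eq_or_ne G F).elim .inr fun h => .inl ⟨h₁, h₂, h₃.ssubset_of_ne h⟩
    · rintro (h | rfl)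
      · exact ⟨h.1, h.2.1, h.2.2.subset⟩
      · exact ⟨hF, hlt, subset_rfl⟩
  have hpos := M.isFlat_loops.natRank_lt hlt hF.subset_ground
  obtain ⟨n, hn⟩ : ∃ n, M.natRank F = n + 1 := ⟨M.natRank F - 1, by omega⟩
  rw [hset, abIndex_restrict hF, chainsIn_union, hn, Nat.add_sub_cancel, chainSum_image2_union
    (finite_chainsIn (M.finite_flatsBetween _ _)) (finite_chainsIn (Set.finite_singleton _)),
    chainSum_chainsIn_singleton (by omega)]
  · intro C hC G hG
    have := (hC.2 hG).1.natRank_lt (hC.2 hG).2.2 hF.subset_ground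
    omega
  · intro D hD G hG
    rw [hD.2 hG]
    omega
  · rintro G hG _ rfl
    exact hG.2.2

lemma chainSum_flats_subset_loops (M : Matroid α) :
    chainSum M.natRank 1 (M.natRank M.loops)
      (chainsIn {G | M.IsFlat G ∧ M.loops ⊂ G ∧ G ⊆ M.loops}) = 1 := by
  have : chainsIn {G | M.IsFlat G ∧ M.loops ⊂ G ∧ G ⊆ M.loops} = {∅} := by
    ext C
    constructor
    · intro hC
      exact Set.eq_empty_iff_forall_notMem.2 fun G hG => (hC.2 hG).2.1.2 (hC.2 hG).2.2
    · rintro rfl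
      exact ⟨by simp, Set.empty_subset _⟩
  rw [this, chainSum, finsum_mem_singleton, natRank_loops]
  simp [rankWord]

end Matroid

/-! ### The deletion formula -/

theorem mainTheorem2 {α : Type*} (M : Matroid α) [M.Finite] (i : α)
    (hi : M.IsNonloop i) (hcoloop : ¬ M.IsColoop i)
    (hparallel : ∀ j, ¬ M.AreParallel i j) :
    abIndex M.FlatLattice
      = abIndex (M.delete {i}).FlatLattice
        + abLetterB * abIndex (M.contract {i}).FlatLattice
        + ∑ᶠ F ∈ M.addableFlats i \ {M.loops},
            abIndex (M.restrict F).FlatLattice * (abLetterA * abLetterB)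
              * abIndex (M.contract (F ∪ {i})).FlatLattice := by
  have hclosure := hi.closure_singleton_eq hparallel
  have hloops : M.loops ∈ M.addableFlats i :=
    ⟨M.isFlat_loops, hi.not_isLoop, hclosure ▸ M.isFlat_closure _⟩
  have hfin := M.finite_addableFlats i
  have hfin' : (⋃ F ∈ M.addableFlats i, M.chainsThrough i F).Finite :=
    hfin.biUnion fun F _ => M.finite_chainsThrough i F
  have hdisj : Disjoint
      (chainsIn {G ∈ M.flatsBetween M.loops M.E | ¬ (i ∈ G ∧ M.IsFlat (G \ {i}))})
      (⋃ F ∈ M.addableFlats i, M.chainsThrough i F) := by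
    refine Set.disjoint_left.2 fun C hC hC' => ?_
    obtain ⟨F, hF, hCF⟩ := Set.mem_iUnion₂.1 hC'
    refine (hC.2 hCF.2.1).2 ⟨.inr rfl, ?_⟩
    rw [Set.union_sdiff_right, Set.sdiff_singleton_eq_self hF.2.1]
    exact hF.1
  have hsplit (f : Set α → FreeAlgebra ℤ (Fin 2)) : ∑ᶠ F ∈ M.addableFlats i, f F
      = f M.loops + ∑ᶠ F ∈ M.addableFlats i \ {M.loops}, f F := by
    rw [← finsum_mem_insert _ (Set.notMem_sdiff_of_mem (Set.mem_singleton _)) hfin.sdiff,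
      Set.insert_sdiff_singleton, Set.insert_eq_of_mem hloops]
  rw [M.abIndex_flatLattice, Matroid.abIndex_delete hi.mem_ground hcoloop,
    M.chainsIn_flatsBetween_eq i, chainSum, finsum_mem_union hdisj
      (finite_chainsIn ((M.finite_flatsBetween _ _).subset (Set.sep_subset _ _))) hfin',
    finsum_mem_biUnion (M.chainsThrough_pairwiseDisjoint i) hfin
      fun F _ => M.finite_chainsThrough i F,
    hsplit, ← add_assoc]
  congr 1
  · congr 1
    refine (Matroid.chainSum_chainsThrough hi hcoloop hloops
      (Set.singleton_subset_iff.2 hi.mem_ground) hclosure).trans ?_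
    rw [M.chainSum_flats_subset_loops, one_mul]
  · refine finsum_mem_congr rfl fun F hF => ?_
    refine (Matroid.chainSum_chainsThrough hi hcoloop hF.1 hF.1.2.2.subset_ground
      hF.1.2.2.closure).trans ?_
    rw [Matroid.chainSum_flats_subset hF.1.1 hF.2]
    simp only [mul_assoc]
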